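/- Let $n\ge 3$ be an integer, let $p$ be a real number with $p\ge p_S:=\frac{n+2}{n-2}$, and define the singular function $$U_*(r):=L\,r^{-2/(p-1)}\quad (r>0),\qquad L>0,\quad L^{p-1}=\frac{2}{(p-1)^2}\bigl((n-2)p-n\bigr).$$ Let $w:(0,\infty)\to(0,\infty)$ be a positive unbounded (classical) solution of the forward self-similar equation $$w''+\Bigl(\frac{n-1}{r}+\frac r2\Bigr)w'+\frac1{p-1}\,w+w^p=0\qquad\text{for } r>0,$$ or of the backward self-similar equation $$w''+\Bigl(\frac{n-1}{r}-\frac r2\Bigr)w'-\frac1{p-1}\,w+w^p=0\qquad\text{for } r>0.$$ If $p=p_S$, assume also that the number of sign changes of $w-U_*$ on $(0,\infty)$ is finite, where the number of sign changes of a function $f$ is the supremum of all integers $k\ge 0$ for which there exist $0<r_0<r_1<\dots<r_k$ with $f(r_{i})f(r_{i+1})<0$ for $0\le i<k$. Then $w(r)=U_*(r)$ for all $r>0$. -/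

import Mathlib

open Set

/-- `w` is twice differentiable at every point of `(0,∞)`. (For a solution of either equation
below, `w''` is then automatically continuous, so that `w` is a classical `C²` solution.) -/
def TwiceDifferentiableOnPos (w : ℝ → ℝ) : Prop :=
  (∀ r : ℝ, 0 < r → DifferentiableAt ℝ w r) ∧ (∀ r : ℝ, 0 < r → DifferentiableAt ℝ (deriv w) r)

/-- `w` is a classical solution on `(0,∞)` of the forward self-similar equation
`w'' + ((n-1)/r + r/2) w' + w/(p-1) + w^p = 0`. -/
def IsForwardSolution (n : ℕ) (p : ℝ) (w : ℝ → ℝ) : Prop :=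
  TwiceDifferentiableOnPos w ∧
    ∀ r : ℝ, 0 < r →
      deriv (deriv w) r + (((n : ℝ) - 1) / r + r / 2) * deriv w r
        + 1 / (p - 1) * w r + (w r) ^ p = 0

/-- `w` is a classical solution on `(0,∞)` of the backward self-similar equation
`w'' + ((n-1)/r - r/2) w' - w/(p-1) + w^p = 0`. -/
def IsBackwardSolution (n : ℕ) (p : ℝ) (w : ℝ → ℝ) : Prop :=
  TwiceDifferentiableOnPos w ∧
    ∀ r : ℝ, 0 < r →
      deriv (deriv w) r + (((n : ℝ) - 1) / r - r / 2) * deriv w r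
        - 1 / (p - 1) * w r + (w r) ^ p = 0

/-- The Sobolev exponent `p_S = (n+2)/(n-2)`, for `n > 2`. (For `n ≤ 2` one has `p_S = ∞`, and
no real `p` satisfies `p ≥ p_S`.) -/
noncomputable def sobolevExponent (n : ℕ) : ℝ := ((n : ℝ) + 2) / ((n : ℝ) - 2)

/-- The constant `L > 0` with `L^(p-1) = 2/(p-1)² ((n-2)p - n)`. -/
noncomputable def singularConstant (n : ℕ) (p : ℝ) : ℝ :=
  (2 / (p - 1) ^ 2 * (((n : ℝ) - 2) * p - (n : ℝ))) ^ (1 / (p - 1))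

/-- The singular solution `U_*(r) = L r^(-2/(p-1))`, `r > 0`. -/
noncomputable def singularSolution (n : ℕ) (p : ℝ) (r : ℝ) : ℝ :=
  singularConstant n p * r ^ (-2 / (p - 1))

/-- The number of sign changes of `f` on `I`: the supremum of all `k` for which there are
`x₀ < x₁ < ⋯ < x_k` in `I` with `f (x_i) f (x_{i+1}) < 0` for all `i < k`. -/
noncomputable def signChangeNumber (f : ℝ → ℝ) (I : Set ℝ) : ℕ∞ :=
  sSup {m : ℕ∞ | ∃ k : ℕ, m = k ∧ ∃ x : Fin (k + 1) → ℝ, StrictMono x ∧ (∀ i, x i ∈ I) ∧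
    ∀ i : Fin k, f (x i.castSucc) * f (x i.succ) < 0}

open Filter Topology

/-! With `m = 2/(p-1)` and `v(s) = e^{ms} w(e^s)`, either equation becomes `v'' + b v' + v^p -
L^{p-1} v = 0`, where `b → β = n - 2 - 2m ≥ 0` as `s → -∞`, and `U_*` becomes the equilibrium `v =
L`. Near `-∞` there are three cases.

If `v` stays above `L`, it is monotone, and a first-order inequality for `v'` would make it blow up
at a finite `s`, unless `v = L` there (`eq_of_ge`). If `v` stays below `L`, it equals `L` or tends
to `0` (`eq_or_tendsto_zero_of_le`); in the latter case a supersolution gives `v = O(e^{ms})`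
(`exists_le_exp_of_tendsto_zero`), so `w` is bounded near the origin. If `v` oscillates about `L`,
then for `p = p_S` there are infinitely many sign changes, while for `p > p_S` the damping takes a
fixed amount of a bounded energy at infinitely many crossings (`not_oscillating`).

Since `w` is also bounded at infinity, unboundedness leaves only `v = L` near `-∞`, and then
everywhere by a Gronwall argument. Boundedness at infinity comes from the decreasing energy in the
forward case. In the backward case it comes from the same comparison and energy lemmas in the
variable `t = -log r`, which is why they allow a coefficient `a` and a general damping. -/

/-- The energy potential of `x ↦ x ^ p - ℓ ^ (p - 1) * x`. -/
noncomputable def potential (p ℓ x : ℝ) : ℝ := x ^ (p + 1) / (p + 1) - ℓ ^ (p - 1) * x ^ 2 / 2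

/-- `v` is a positive solution on `ℝ` of `v'' + b v' + a (v ^ p - ℓ ^ (p - 1) v) = 0`. -/
structure IsPosOrbit (p ℓ : ℝ) (a b v v' : ℝ → ℝ) : Prop where
  pos : ∀ s, 0 < v s
  hasDerivAt : ∀ s, HasDerivAt v (v' s) s
  hasDerivAt' : ∀ s, HasDerivAt v' (-(b s * v' s) - a s * (v s ^ p - ℓ ^ (p - 1) * v s)) s

/-- `P` is an integrating factor for the damping `b`, bounded near `-∞`, and `Q` is an
integrating factor for a larger damping `q`, dominated by the coefficient `a`, which vanishes
at `-∞`. -/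
structure IsWeightPair (a b q P Q : ℝ → ℝ) (c C s₀ : ℝ) : Prop where
  c_pos : 0 < c
  P_pos : ∀ s, 0 < P s
  P_deriv : ∀ s, HasDerivAt P (b s * P s) s
  P_le : ∀ s ≤ s₀, P s ≤ C
  Q_pos : ∀ s, 0 < Q s
  Q_deriv : ∀ s, HasDerivAt Q (q s * Q s) s
  Q_lim : Tendsto Q atBot (𝓝 0)
  a_nonneg : ∀ s, 0 ≤ a s
  b_le : ∀ s ≤ s₀, b s ≤ q s
  q_le : ∀ s ≤ s₀, c * q s ≤ a s

theorem antitoneOn_of_hasDerivAt_nonpos {D : Set ℝ} (hD : Convex ℝ D) {g g' : ℝ → ℝ}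
    (hg : ∀ s, HasDerivAt g (g' s) s) (h : ∀ s ∈ D, g' s ≤ 0) : AntitoneOn g D :=
  antitoneOn_of_hasDerivWithinAt_nonpos hD (fun s _ => (hg s).continuousAt.continuousWithinAt)
    (fun s _ => (hg s).hasDerivWithinAt) (fun s hs => h s (interior_subset hs))

theorem monotoneOn_of_hasDerivAt_nonneg {D : Set ℝ} (hD : Convex ℝ D) {g g' : ℝ → ℝ}
    (hg : ∀ s, HasDerivAt g (g' s) s) (h : ∀ s ∈ D, 0 ≤ g' s) : MonotoneOn g D :=
  monotoneOn_of_hasDerivWithinAt_nonneg hD (fun s _ => (hg s).continuousAt.continuousWithinAt)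
    (fun s _ => (hg s).hasDerivWithinAt) (fun s hs => h s (interior_subset hs))

/-- A positive function cannot have a derivative bounded below by a positive constant
near `-∞`. -/
theorem false_of_pos_of_le_deriv {g g' : ℝ → ℝ} {s₁ d : ℝ} (hg : ∀ s, HasDerivAt g (g' s) s)
    (hd : 0 < d) (h : ∀ s ≤ s₁, d ≤ g' s) (hpos : ∀ s ≤ s₁, 0 < g s) : False := by
  have hm : MonotoneOn (fun s => g s - d * s) (Iic s₁) := by
    refine monotoneOn_of_hasDerivAt_nonneg (convex_Iic _) (g' := fun s => g' s - d) (fun s => ?_)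
      (fun s hs => sub_nonneg.2 (h s hs))
    exact ((hg s).sub ((hasDerivAt_id s).const_mul d)).congr_deriv (by simp)
  have h0 := hpos s₁ le_rfl
  have hle : s₁ - g s₁ / d ≤ s₁ := by linarith [div_pos h0 hd]
  have h1 := hm hle (mem_Iic.2 le_rfl) hle
  have h2 := hpos _ hle
  have h3 : d * (s₁ - g s₁ / d) = d * s₁ - g s₁ := by field_simp
  simp only [h3] at h1
  linarith

/-! ### The nonlinearity and its potential well. -/

section Nonlinearity

variable {p ℓ : ℝ}

theorem rpow_sub_mul_eq {x : ℝ} (hx : 0 < x) :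
    x ^ p - ℓ ^ (p - 1) * x = x * (x ^ (p - 1) - ℓ ^ (p - 1)) := by
  have : x ^ p = x ^ (p - 1) * x := by
    rw [← Real.rpow_add_one hx.ne']; ring_nf
  rw [this]; ring

theorem rpow_sub_mul_mono (hp : 1 < p) (hℓ : 0 < ℓ) {x y : ℝ} (hx : ℓ ≤ x) (hxy : x ≤ y) :
    x ^ p - ℓ ^ (p - 1) * x ≤ y ^ p - ℓ ^ (p - 1) * y := by
  have hx0 : 0 < x := hℓ.trans_le hx
  rw [rpow_sub_mul_eq hx0, rpow_sub_mul_eq (hx0.trans_le hxy)]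
  have h1 : ℓ ^ (p - 1) ≤ x ^ (p - 1) := Real.rpow_le_rpow hℓ.le hx (by linarith)
  have h2 : x ^ (p - 1) ≤ y ^ (p - 1) := Real.rpow_le_rpow hx0.le hxy (by linarith)
  exact mul_le_mul hxy (by linarith) (by linarith) (by linarith)

theorem rpow_sub_mul_nonneg (hp : 1 < p) (hℓ : 0 < ℓ) {x : ℝ} (hx : ℓ ≤ x) :
    0 ≤ x ^ p - ℓ ^ (p - 1) * x := by
  rw [rpow_sub_mul_eq (hℓ.trans_le hx)]
  have h1 : ℓ ^ (p - 1) ≤ x ^ (p - 1) := Real.rpow_le_rpow hℓ.le hx (by linarith)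
  exact mul_nonneg (by linarith) (by linarith)

theorem rpow_sub_mul_nonpos (hp : 1 < p) {x : ℝ} (h0 : 0 < x) (hx : x ≤ ℓ) :
    x ^ p - ℓ ^ (p - 1) * x ≤ 0 := by
  rw [rpow_sub_mul_eq h0]
  have h1 : x ^ (p - 1) ≤ ℓ ^ (p - 1) := Real.rpow_le_rpow h0.le hx (by linarith)
  exact mul_nonpos_of_nonneg_of_nonpos h0.le (by linarith)

theorem potential_lt (hp : 1 < p) (hℓ : 0 < ℓ) {x : ℝ} (hx : 0 < x) (hne : x ≠ ℓ) :
    potential p ℓ ℓ < potential p ℓ x := by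
  obtain ⟨t, ht, rfl⟩ : ∃ t, 0 < t ∧ x = ℓ * t := ⟨x / ℓ, by positivity, by field_simp⟩
  have ht1 : t ≠ 1 := fun h => hne (by simp [h])
  -- After scaling by `ℓ`, strict minimality is Bernoulli's strict inequality for `(t²)^((p+1)/2)`.
  have hB := one_add_mul_self_lt_rpow_one_add (s := t ^ 2 - 1) (p := (p + 1) / 2)
    (by nlinarith [sq_nonneg t]) (by
      intro h
      have : (t - 1) * (t + 1) = 0 := by linarith
      rcases mul_eq_zero.1 this with h | h
      · exact ht1 (by linarith)
      · linarith) (by linarith)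
  have h2 : (1 + (t ^ 2 - 1)) ^ ((p + 1) / 2) = t ^ (p + 1) := by
    rw [add_sub_cancel, ← Real.rpow_natCast, ← Real.rpow_mul ht.le]
    congr 1; push_cast; ring
  rw [h2] at hB
  have h3 : ℓ ^ (p + 1) = ℓ ^ (p - 1) * ℓ ^ 2 := by
    rw [← Real.rpow_natCast, ← Real.rpow_add hℓ]; congr 1; push_cast; ring
  have h4 : potential p ℓ (ℓ * t) - potential p ℓ ℓ
      = ℓ ^ (p - 1) * ℓ ^ 2 / (p + 1) * (t ^ (p + 1) - (1 + (p + 1) / 2 * (t ^ 2 - 1))) := by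
    have : p + 1 ≠ 0 := by linarith
    simp only [potential, Real.mul_rpow hℓ.le ht.le, h3]
    field_simp
    ring
  have h5 : 0 < ℓ ^ (p - 1) * ℓ ^ 2 / (p + 1) * (t ^ (p + 1) - (1 + (p + 1) / 2 * (t ^ 2 - 1))) :=
    mul_pos (by positivity) (by linarith)
  linarith

theorem potential_le (hp : 1 < p) (hℓ : 0 < ℓ) {x : ℝ} (hx : 0 < x) :
    potential p ℓ ℓ ≤ potential p ℓ x := by
  rcases eq_or_ne x ℓ with rfl | h
  · rfl
  · exact (potential_lt hp hℓ hx h).le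

theorem potential_eq {x : ℝ} (hx : 0 < x) :
    potential p ℓ x = x ^ 2 * (x ^ (p - 1) / (p + 1) - ℓ ^ (p - 1) / 2) := by
  have : x ^ (p + 1) = x ^ (p - 1) * x ^ 2 := by
    rw [← Real.rpow_natCast, ← Real.rpow_add hx]; congr 1; push_cast; ring
  rw [potential, this]; ring

theorem potential_neg (hp : 1 < p) (hℓ : 0 < ℓ) {x : ℝ} (hx : 0 < x) (hxl : x ≤ ℓ) :
    potential p ℓ x < 0 := by
  rw [potential_eq hx]
  have h1 : x ^ (p - 1) ≤ ℓ ^ (p - 1) := Real.rpow_le_rpow hx.le hxl (by linarith)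
  have h2 : 0 < ℓ ^ (p - 1) := by positivity
  have h3 : x ^ (p - 1) / (p + 1) < ℓ ^ (p - 1) / 2 := by
    rw [div_lt_div_iff₀ (by linarith) two_pos]; nlinarith
  exact mul_neg_of_pos_of_neg (by positivity) (by linarith)

/-- The potential is coercive. -/
theorem exists_bound_of_potential_le (hp : 1 < p) (ℓ e : ℝ) :
    ∃ M, ∀ x, 0 < x → potential p ℓ x ≤ e → x ≤ M := by
  have hp1 : 0 < p - 1 := by linarith
  obtain ⟨M, hM1, hM⟩ : ∃ M : ℝ, 1 ≤ M ∧ |e| + 1 + ℓ ^ (p - 1) / 2 ≤ M ^ (p - 1) / (p + 1) := by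
    have ht : Tendsto (fun x : ℝ => x ^ (p - 1) / (p + 1)) atTop atTop :=
      (tendsto_rpow_atTop hp1).atTop_div_const (by linarith)
    exact ((eventually_ge_atTop 1).and
      (ht.eventually_ge_atTop (|e| + 1 + ℓ ^ (p - 1) / 2))).exists
  refine ⟨M, fun x hx he => ?_⟩
  by_contra! hlt
  rw [potential_eq hx] at he
  have h1 : M ^ (p - 1) / (p + 1) ≤ x ^ (p - 1) / (p + 1) := by
    have := Real.rpow_le_rpow (by linarith) hlt.le hp1.le
    gcongr
  have h2 : 1 ≤ x ^ 2 := one_le_pow₀ (by linarith)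
  have h3 := le_abs_self e
  have h4 := abs_nonneg e
  nlinarith

theorem hasDerivAt_potential (hp : 1 < p) {x : ℝ} (hx : 0 < x) :
    HasDerivAt (potential p ℓ) (x ^ p - ℓ ^ (p - 1) * x) x := by
  have h1 := (Real.hasDerivAt_rpow_const (x := x) (p := p + 1) (Or.inl hx.ne')).div_const (p + 1)
  have h2 := ((hasDerivAt_pow 2 x).const_mul (ℓ ^ (p - 1))).div_const 2
  refine (h1.sub h2).congr_deriv ?_
  have : p + 1 ≠ 0 := by linarith
  rw [add_sub_cancel_right]
  field_simp
  ring

end Nonlinearity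

/-! ### Orbits on one side of the equilibrium near `-∞`. -/

namespace IsPosOrbit

variable {p ℓ : ℝ} {a b v v' q P Q : ℝ → ℝ} {c C s₀ : ℝ}

theorem hasDerivAt_weight (h : IsPosOrbit p ℓ a b v v') (hw : IsWeightPair a b q P Q c C s₀)
    (s : ℝ) :
    HasDerivAt (fun s => P s * v' s) (-(P s * a s * (v s ^ p - ℓ ^ (p - 1) * v s))) s :=
  ((hw.P_deriv s).mul (h.hasDerivAt' s)).congr_deriv (by ring)

/-- Above `ℓ` the flux `P v'` is nonincreasing. A positive value of it would persist towards `-∞`,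
and since `P ≤ C` this bounds `v'` below, forcing `v` to become negative. -/
theorem deriv_nonpos_of_ge (h : IsPosOrbit p ℓ a b v v') (hp : 1 < p) (hℓ : 0 < ℓ)
    (hw : IsWeightPair a b q P Q c C s₀) (hv : ∀ s ≤ s₀, ℓ ≤ v s) :
    ∀ s ≤ s₀, v' s ≤ 0 := by
  intro s₁ hs₁
  by_contra! hpos
  have hanti : AntitoneOn (fun s => P s * v' s) (Iic s₀) :=
    antitoneOn_of_hasDerivAt_nonpos (convex_Iic _) (h.hasDerivAt_weight hw) fun s hs =>
      neg_nonpos.2 (mul_nonneg (mul_nonneg (hw.P_pos s).le (hw.a_nonneg s))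
        (rpow_sub_mul_nonneg hp hℓ (hv s hs)))
  have hC : 0 < C := (hw.P_pos s₁).trans_le (hw.P_le s₁ hs₁)
  have hd : 0 < P s₁ * v' s₁ := mul_pos (hw.P_pos s₁) hpos
  refine false_of_pos_of_le_deriv (s₁ := s₁) h.hasDerivAt (div_pos hd hC) (fun s hs => ?_)
    (fun s _ => h.pos s)
  have h1 : P s₁ * v' s₁ ≤ P s * v' s := hanti (hs.trans hs₁) hs₁ hs
  have h2 : 0 < v' s := by
    by_contra! hc
    nlinarith [hw.P_pos s]
  rw [div_le_iff₀ hC]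
  nlinarith [hw.P_le s (hs.trans hs₁)]

theorem deriv_nonneg_of_le (h : IsPosOrbit p ℓ a b v v') (hp : 1 < p)
    (hw : IsWeightPair a b q P Q c C s₀) (hv : ∀ s ≤ s₀, v s ≤ ℓ) :
    ∀ s ≤ s₀, 0 ≤ v' s := by
  intro s₁ hs₁
  by_contra! hneg
  have hmono : MonotoneOn (fun s => P s * v' s) (Iic s₀) :=
    monotoneOn_of_hasDerivAt_nonneg (convex_Iic _) (h.hasDerivAt_weight hw) fun s hs =>
      neg_nonneg.2 (mul_nonpos_of_nonneg_of_nonpos (mul_nonneg (hw.P_pos s).le (hw.a_nonneg s))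
        (rpow_sub_mul_nonpos hp (h.pos s) (hv s hs)))
  have hC : 0 < C := (hw.P_pos s₁).trans_le (hw.P_le s₁ hs₁)
  have hd : 0 < -(P s₁ * v' s₁) := neg_pos.2 (mul_neg_of_pos_of_neg (hw.P_pos s₁) hneg)
  -- The positive function with derivative bounded below is `ℓ + 1 - v`.
  refine false_of_pos_of_le_deriv (s₁ := s₁) (fun s => (h.hasDerivAt s).const_sub (ℓ + 1))
    (div_pos hd hC) (fun s hs => ?_) (fun s hs => by linarith [hv s (hs.trans hs₁)])
  have h1 : P s * v' s ≤ P s₁ * v' s₁ := hmono (hs.trans hs₁) hs₁ hs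
  have h2 : v' s < 0 := by
    by_contra! hc
    nlinarith [hw.P_pos s]
  rw [div_le_iff₀ hC]
  nlinarith [hw.P_le s (hs.trans hs₁)]

/-- Reduces the equation to a first-order inequality, superlinear in `v`. The nonlinearity is frozen
at its value `f` at `s₁`, a lower bound on `(-∞, s₁]` because `v` is nonincreasing; then `Q (v' + c
f)` is nonincreasing and its upper bound `c f Q` vanishes at `-∞`. -/
theorem deriv_le_of_ge (h : IsPosOrbit p ℓ a b v v') (hp : 1 < p) (hℓ : 0 < ℓ)
    (hw : IsWeightPair a b q P Q c C s₀) (hv : ∀ s ≤ s₀, ℓ ≤ v s) :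
    ∀ s ≤ s₀, v' s ≤ -(c * (v s ^ p - ℓ ^ (p - 1) * v s)) := by
  have hv' := h.deriv_nonpos_of_ge hp hℓ hw hv
  have hvanti : AntitoneOn v (Iic s₀) :=
    antitoneOn_of_hasDerivAt_nonpos (convex_Iic _) h.hasDerivAt hv'
  intro s₁ hs₁
  set f := v s₁ ^ p - ℓ ^ (p - 1) * v s₁ with hf
  have hf0 : 0 ≤ f := rpow_sub_mul_nonneg hp hℓ (hv s₁ hs₁)
  have hanti : AntitoneOn (fun s => Q s * (v' s + c * f)) (Iic s₁) := by
    refine antitoneOn_of_hasDerivAt_nonpos (convex_Iic _)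
      (fun s => (hw.Q_deriv s).mul ((h.hasDerivAt' s).add_const (c * f))) fun s hs => ?_
    have hs0 : s ≤ s₀ := le_trans hs hs₁
    have h1 : f ≤ v s ^ p - ℓ ^ (p - 1) * v s :=
      rpow_sub_mul_mono hp hℓ (hv s₁ hs₁) (hvanti hs0 hs₁ hs)
    have h2 : (q s - b s) * v' s ≤ 0 :=
      mul_nonpos_of_nonneg_of_nonpos (by linarith [hw.b_le s hs0]) (hv' s hs0)
    have h3 : c * q s * f ≤ a s * f := mul_le_mul_of_nonneg_right (hw.q_le s hs0) hf0
    have h4 := mul_le_mul_of_nonneg_left h1 (hw.a_nonneg s)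
    have h5 : Q s * ((q s - b s) * v' s + c * q s * f
        - a s * (v s ^ p - ℓ ^ (p - 1) * v s)) ≤ 0 :=
      mul_nonpos_of_nonneg_of_nonpos (hw.Q_pos s).le (by linarith)
    linarith
  have hlim : Tendsto (fun t => Q t * (c * f)) atBot (𝓝 0) := by
    simpa using hw.Q_lim.mul_const (c * f)
  have h0 : Q s₁ * (v' s₁ + c * f) ≤ 0 := by
    refine ge_of_tendsto hlim ((eventually_le_atBot s₁).mono fun t ht => ?_)
    refine (hanti ht (mem_Iic.2 le_rfl) ht).trans ?_
    exact mul_le_mul_of_nonneg_left (by linarith [hv' t (ht.trans hs₁)]) (hw.Q_pos t).le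
  have := hw.Q_pos s₁
  by_contra! hc
  nlinarith

/-- A positive orbit that stays above the equilibrium near `-∞` is constant there. -/
theorem eq_of_ge (h : IsPosOrbit p ℓ a b v v') (hp : 1 < p) (hℓ : 0 < ℓ)
    (hw : IsWeightPair a b q P Q c C s₀) (hv : ∀ s ≤ s₀, ℓ ≤ v s) :
    ∀ s ≤ s₀, v s = ℓ := by
  have hv' := h.deriv_le_of_ge hp hℓ hw hv
  have hvanti : AntitoneOn v (Iic s₀) :=
    antitoneOn_of_hasDerivAt_nonpos (convex_Iic _) h.hasDerivAt
      (h.deriv_nonpos_of_ge hp hℓ hw hv)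
  intro s₁ hs₁
  by_contra hne
  have hlt : ℓ < v s₁ := lt_of_le_of_ne (hv s₁ hs₁) (Ne.symm hne)
  have hp1 : 0 < p - 1 := by linarith
  have hd : 0 < 1 - ℓ ^ (p - 1) * v s₁ ^ (1 - p) := by
    have h1 : ℓ ^ (p - 1) < v s₁ ^ (p - 1) := Real.rpow_lt_rpow hℓ.le hlt hp1
    have h2 : v s₁ ^ (p - 1) * v s₁ ^ (1 - p) = 1 := by
      rw [← Real.rpow_add (h.pos s₁)]; simp
    have h3 : 0 < v s₁ ^ (1 - p) := Real.rpow_pos_of_pos (h.pos s₁) _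
    nlinarith
  -- Backward blow-up of `v` is seen as `v^(1-p)` reaching `0`: its derivative is at least `(p-1) c
  -- (1 - ℓ^(p-1) v^(1-p))`, which is bounded below since `v ≥ v s₁ > ℓ`.
  refine false_of_pos_of_le_deriv (s₁ := s₁) (g := fun s => v s ^ (1 - p))
    (fun s => (h.hasDerivAt s).rpow_const (Or.inl (h.pos s).ne'))
    (mul_pos (mul_pos hp1 hw.c_pos) hd) (fun s hs => ?_)
    (fun s _ => Real.rpow_pos_of_pos (h.pos s) _)
  have hvs := h.pos s
  have h1 : v s ^ (1 - p) ≤ v s₁ ^ (1 - p) :=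
    Real.rpow_le_rpow_of_nonpos (h.pos s₁) (hvanti (hs.trans hs₁) hs₁ hs) (by linarith)
  have h2 : (v s ^ p - ℓ ^ (p - 1) * v s) * v s ^ (1 - p - 1)
      = 1 - ℓ ^ (p - 1) * v s ^ (1 - p) := by
    have e1 : v s ^ p * v s ^ (1 - p - 1) = 1 := by
      rw [← Real.rpow_add hvs]; ring_nf; simp
    have e2 : v s * v s ^ (1 - p - 1) = v s ^ (1 - p) := by
      rw [mul_comm, ← Real.rpow_add_one hvs.ne']; ring_nf
    rw [sub_mul, e1, mul_assoc, e2]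
  have h3 : 0 < v s ^ (1 - p - 1) := Real.rpow_pos_of_pos hvs _
  have h4 : c * (1 - ℓ ^ (p - 1) * v s ^ (1 - p)) ≤ -v' s * v s ^ (1 - p - 1) := by
    rw [← h2, ← mul_assoc]
    exact mul_le_mul_of_nonneg_right (by linarith [hv' s (hs.trans hs₁)]) h3.le
  have h5 : ℓ ^ (p - 1) * v s ^ (1 - p) ≤ ℓ ^ (p - 1) * v s₁ ^ (1 - p) :=
    mul_le_mul_of_nonneg_left h1 (by positivity)
  have h6 : c * (1 - ℓ ^ (p - 1) * v s₁ ^ (1 - p)) ≤ -v' s * v s ^ (1 - p - 1) :=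
    le_trans (mul_le_mul_of_nonneg_left (by linarith) hw.c_pos.le) h4
  have := mul_le_mul_of_nonneg_left h6 hp1.le
  linarith

/-- A positive orbit that stays below the equilibrium near `-∞` is constant there or tends
to `0`. -/
theorem eq_or_tendsto_zero_of_le (h : IsPosOrbit p ℓ a b v v') (hp : 1 < p)
    (hw : IsWeightPair a b q P Q c C s₀) (hv : ∀ s ≤ s₀, v s ≤ ℓ) :
    (∀ s ≤ s₀, v s = ℓ) ∨ Tendsto v atBot (𝓝 0) := by
  have hv' := h.deriv_nonneg_of_le hp hw hv
  have hvmono : MonotoneOn v (Iic s₀) :=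
    monotoneOn_of_hasDerivAt_nonneg (convex_Iic _) h.hasDerivAt hv'
  by_contra! hcon
  obtain ⟨⟨s₁, hs₁, hne⟩, hnlim⟩ := hcon
  have hlt : v s₁ < ℓ := lt_of_le_of_ne (hv s₁ hs₁) hne
  obtain ⟨δ, hδ, hδv⟩ : ∃ δ > 0, ∀ s ≤ s₁, δ ≤ v s := by
    by_contra! hc
    refine hnlim (tendsto_order.2 ⟨fun x hx => Eventually.of_forall fun s => hx.trans (h.pos s),
      fun δ hδ => ?_⟩)
    obtain ⟨t, ht, htδ⟩ := hc δ hδ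
    filter_upwards [eventually_le_atBot t] with s hs
    exact (hvmono (hs.trans (ht.trans hs₁)) (ht.trans hs₁) hs).trans_lt htδ
  -- On `(-∞, s₁]` the orbit stays away from both zeros `0` and `ℓ` of the nonlinearity, so the
  -- restoring force is at least `κ`; integrating with `Q` then gives `v' ≥ c κ`.
  set κ := δ * (ℓ ^ (p - 1) - v s₁ ^ (p - 1)) with hκ
  have hlt' : v s₁ ^ (p - 1) < ℓ ^ (p - 1) :=
    Real.rpow_lt_rpow (h.pos s₁).le hlt (by linarith)
  have hκ0 : 0 < κ := mul_pos hδ (by linarith)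
  have hf : ∀ s ≤ s₁, v s ^ p - ℓ ^ (p - 1) * v s ≤ -κ := by
    intro s hs
    rw [rpow_sub_mul_eq (h.pos s)]
    have h1 : v s ^ (p - 1) ≤ v s₁ ^ (p - 1) :=
      Real.rpow_le_rpow (h.pos s).le (hvmono (hs.trans hs₁) hs₁ hs) (by linarith)
    have h2 := hδv s hs
    nlinarith
  have hmono : MonotoneOn (fun s => Q s * (v' s + -(c * κ))) (Iic s₁) := by
    refine monotoneOn_of_hasDerivAt_nonneg (convex_Iic _)
      (fun s => (hw.Q_deriv s).mul ((h.hasDerivAt' s).add_const (-(c * κ)))) fun s hs => ?_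
    have hs0 : s ≤ s₀ := le_trans hs hs₁
    have h2 : 0 ≤ (q s - b s) * v' s :=
      mul_nonneg (by linarith [hw.b_le s hs0]) (hv' s hs0)
    have h3 : c * q s * κ ≤ a s * κ := mul_le_mul_of_nonneg_right (hw.q_le s hs0) hκ0.le
    have h4 := mul_le_mul_of_nonneg_left (hf s hs) (hw.a_nonneg s)
    have h5 : 0 ≤ Q s * ((q s - b s) * v' s - c * q s * κ
        - a s * (v s ^ p - ℓ ^ (p - 1) * v s)) :=
      mul_nonneg (hw.Q_pos s).le (by linarith)
    linarith
  have hlim : Tendsto (fun t => Q t * (-(c * κ))) atBot (𝓝 0) := by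
    simpa using hw.Q_lim.mul_const (-(c * κ))
  refine false_of_pos_of_le_deriv (s₁ := s₁) h.hasDerivAt (mul_pos hw.c_pos hκ0)
    (fun s hs => ?_) (fun s _ => h.pos s)
  have h0 : 0 ≤ Q s * (v' s + -(c * κ)) := by
    refine le_of_tendsto hlim ((eventually_le_atBot s).mono fun t ht => ?_)
    refine le_trans ?_ (hmono (ht.trans hs) hs ht)
    exact mul_le_mul_of_nonneg_left (by linarith [hv' t (ht.trans (hs.trans hs₁))])
      (hw.Q_pos t).le
  have := hw.Q_pos s
  by_contra! hc
  nlinarith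

end IsPosOrbit

/-- A function tending to `0` at `-∞`, nonpositive at `s₀` and strictly convex at its positive
critical points is nonpositive on `(-∞, s₀]`. -/
theorem nonpos_of_strictConvex_at_pos_critical {u u' u'' : ℝ → ℝ} {s₀ : ℝ}
    (hu : ∀ s, HasDerivAt u (u' s) s) (hu' : ∀ s, HasDerivAt u' (u'' s) s) (h0 : u s₀ ≤ 0)
    (hlim : Tendsto u atBot (𝓝 0)) (hc : ∀ s ≤ s₀, 0 < u s → u' s = 0 → 0 < u'' s) :
    ∀ s ≤ s₀, u s ≤ 0 := by
  intro s₁ hs₁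
  by_contra! hpos
  obtain ⟨t, ht, hts⟩ := (((tendsto_order.1 hlim).2 _ hpos).and (eventually_le_atBot s₁)).exists
  have hcont : Continuous u := continuous_iff_continuousAt.2 fun s => (hu s).continuousAt
  obtain ⟨x, hx, hmax⟩ := isCompact_Icc.exists_isMaxOn (nonempty_Icc.2 (hts.trans hs₁))
    (hcont.continuousOn (s := Icc t s₀))
  have hxs : u s₁ ≤ u x := hmax ⟨hts, hs₁⟩
  have hxt : t < x := lt_of_le_of_ne hx.1 (by rintro rfl; linarith)
  have hx0 : x < s₀ := lt_of_le_of_ne hx.2 (by rintro rfl; linarith)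
  have hlmax : IsLocalMax u x := hmax.isLocalMax (Icc_mem_nhds hxt hx0)
  have hux : u' x = 0 := hlmax.hasDerivAt_eq_zero (hu x)
  have hx2 := hc x hx.2 (by linarith) hux
  have hderiv : deriv u = u' := funext fun s => (hu s).deriv
  -- The interior maximum is also a local minimum, so `u` is locally constant there, against `u'' >
  -- 0`.
  have hlmin : IsLocalMin u x := isLocalMin_of_deriv_deriv_pos
    (by rw [hderiv, (hu' x).deriv]; exact hx2) (by rw [hderiv, hux]) hcont.continuousAt
  have heq : u =ᶠ[𝓝 x] fun _ => u x := by
    filter_upwards [hlmin, hlmax] with y h1 h2 using le_antisymm h2 h1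
  have h2 : deriv u =ᶠ[𝓝 x] fun _ => 0 := by
    simpa using heq.deriv
  rw [hderiv] at h2
  have h3 := h2.deriv_eq
  rw [(hu' x).deriv, deriv_const] at h3
  linarith

/-! ### Energy, oscillation, uniqueness and decay. -/

namespace IsPosOrbit

variable {p ℓ : ℝ} {a a' b v v' : ℝ → ℝ} {s₀ : ℝ}

theorem continuous (h : IsPosOrbit p ℓ a b v v') : Continuous v :=
  continuous_iff_continuousAt.2 fun s => (h.hasDerivAt s).continuousAt

/-- Between two points above `ℓ` with one below in between, the minimum is interior. -/
theorem exists_critical_lt (h : IsPosOrbit p ℓ a b v v') (hlt : ∀ t, ∃ s ≤ t, v s < ℓ)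
    (hgt : ∀ t, ∃ s ≤ t, ℓ < v s) (t : ℝ) : ∃ s ≤ t, v' s = 0 ∧ v s < ℓ := by
  obtain ⟨x₃, hx₃, h₃⟩ := hgt t
  obtain ⟨x₂, hx₂, h₂⟩ := hlt x₃
  obtain ⟨x₁, hx₁, h₁⟩ := hgt x₂
  obtain ⟨x, hx, hmin⟩ := isCompact_Icc.exists_isMinOn (nonempty_Icc.2 (hx₁.trans hx₂))
    (h.continuous.continuousOn (s := Icc x₁ x₃))
  have hxl : v x < ℓ := lt_of_le_of_lt (hmin ⟨hx₁, hx₂⟩) h₂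
  have hxt : x₁ < x := lt_of_le_of_ne hx.1 (by rintro rfl; linarith)
  have hx0 : x < x₃ := lt_of_le_of_ne hx.2 (by rintro rfl; linarith)
  exact ⟨x, hx.2.trans hx₃,
    (hmin.isLocalMin (Icc_mem_nhds hxt hx0)).hasDerivAt_eq_zero (h.hasDerivAt x), hxl⟩

theorem hasDerivAt_energy (h : IsPosOrbit p ℓ a b v v') (hp : 1 < p) (ha : ∀ s, 0 < a s)
    (ha' : ∀ s, HasDerivAt a (a' s) s) (s : ℝ) :
    HasDerivAt (fun s => v' s ^ 2 / (2 * a s) + potential p ℓ (v s))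
      (-((b s + a' s / (2 * a s)) / a s * v' s ^ 2)) s := by
  have h0 := (ha s).ne'
  have h1 := ((h.hasDerivAt' s).pow 2).div ((ha' s).const_mul 2) (by positivity)
  have h2 := (hasDerivAt_potential (ℓ := ℓ) hp (h.pos s)).comp s (h.hasDerivAt s)
  refine (h1.add h2).congr_deriv ?_
  simp only [Pi.pow_apply]
  field_simp
  ring

theorem hasDerivAt_energy_one (h : IsPosOrbit p ℓ (fun _ => 1) b v v') (hp : 1 < p) (s : ℝ) :
    HasDerivAt (fun s => v' s ^ 2 / 2 + potential p ℓ (v s)) (-(b s * v' s ^ 2)) s := by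
  simpa using h.hasDerivAt_energy hp (fun _ => one_pos) (fun s => hasDerivAt_const s (1 : ℝ)) s

/-- At an earlier critical point below `ℓ` the energy is purely potential, hence negative, and it
does not increase afterwards. -/
theorem energy_neg (h : IsPosOrbit p ℓ a b v v') (hp : 1 < p) (hℓ : 0 < ℓ)
    (hlt : ∀ t, ∃ s ≤ t, v s < ℓ) (hgt : ∀ t, ∃ s ≤ t, ℓ < v s)
    (hE : AntitoneOn (fun s => v' s ^ 2 / (2 * a s) + potential p ℓ (v s)) (Iic s₀)) :
    ∀ s ≤ s₀, v' s ^ 2 / (2 * a s) + potential p ℓ (v s) < 0 := by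
  intro s hs
  obtain ⟨t, hts, ht0, htl⟩ := h.exists_critical_lt hlt hgt s
  refine (hE (hts.trans hs) hs hts).trans_lt ?_
  simpa [ht0] using potential_neg hp hℓ (h.pos t) htl.le

/-- A positive orbit whose energy is nonincreasing near `-∞` is bounded there if it
oscillates around the equilibrium. -/
theorem bounded_of_oscillating (h : IsPosOrbit p ℓ a b v v') (hp : 1 < p) (hℓ : 0 < ℓ)
    (ha : ∀ s, 0 < a s) (hlt : ∀ t, ∃ s ≤ t, v s < ℓ) (hgt : ∀ t, ∃ s ≤ t, ℓ < v s)
    (hE : AntitoneOn (fun s => v' s ^ 2 / (2 * a s) + potential p ℓ (v s)) (Iic s₀)) :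
    ∃ M, ∀ s ≤ s₀, v s ≤ M := by
  obtain ⟨M, hM⟩ := exists_bound_of_potential_le hp ℓ 0
  refine ⟨M, fun s hs => hM _ (h.pos s) ?_⟩
  have h1 := h.energy_neg hp hℓ hlt hgt hE s hs
  have h2 : 0 ≤ v' s ^ 2 / (2 * a s) := by have := ha s; positivity
  linarith

/-- Under positive damping no positive orbit oscillates around the equilibrium at `-∞`. -/
theorem not_oscillating (h : IsPosOrbit p ℓ (fun _ => 1) b v v') (hp : 1 < p) (hℓ : 0 < ℓ)
    {c B : ℝ} (hc : 0 < c) (hbc : ∀ s ≤ s₀, c ≤ b s) (hbB : ∀ s ≤ s₀, b s ≤ B)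
    (hlt : ∀ t, ∃ s ≤ t, v s < ℓ) (hgt : ∀ t, ∃ s ≤ t, ℓ < v s) : False := by
  set E : ℝ → ℝ := fun s => v' s ^ 2 / 2 + potential p ℓ (v s) with hEdef
  have hE' : ∀ s, HasDerivAt E (-(b s * v' s ^ 2)) s := h.hasDerivAt_energy_one hp
  have hE : AntitoneOn E (Iic s₀) :=
    antitoneOn_of_hasDerivAt_nonpos (convex_Iic _) hE' fun s hs =>
      neg_nonpos.2 (mul_nonneg (hc.le.trans (hbc s hs)) (sq_nonneg _))
  have hEneg : ∀ s ≤ s₀, E s < 0 := by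
    simpa [hEdef] using h.energy_neg hp hℓ hlt hgt (s₀ := s₀) (by simpa [hEdef] using hE)
  obtain ⟨M, hM⟩ := h.bounded_of_oscillating hp hℓ (fun _ => one_pos) hlt hgt (s₀ := s₀)
    (by simpa [hEdef] using hE)
  obtain ⟨V, hV0, hV⟩ : ∃ V, 0 ≤ V ∧ ∀ s ≤ s₀, |v' s| ≤ V := by
    refine ⟨√(2 * -potential p ℓ ℓ), Real.sqrt_nonneg _, fun s hs => Real.abs_le_sqrt ?_⟩
    have h1 := hEneg s hs
    have h2 := potential_le hp hℓ (h.pos s)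
    simp only [hEdef] at h1
    linarith
  obtain ⟨K, hK0, hK⟩ : ∃ K, 0 < K ∧ ∀ s ≤ s₀,
      ‖-(b s * v' s) - 1 * (v s ^ p - ℓ ^ (p - 1) * v s)‖ ≤ K := by
    have hB : 0 < B := hc.trans_le ((hbc s₀ le_rfl).trans (hbB s₀ le_rfl))
    have hM0 : 0 < M := (h.pos s₀).trans_le (hM s₀ le_rfl)
    refine ⟨B * V + (M ^ p + ℓ ^ (p - 1) * M), by positivity, fun s hs => ?_⟩
    have h1 : |b s * v' s| ≤ B * V := by
      rw [abs_mul, abs_of_pos (hc.trans_le (hbc s hs))]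
      exact mul_le_mul (hbB s hs) (hV s hs) (abs_nonneg _) hB.le
    have h2 : v s ^ p ≤ M ^ p := Real.rpow_le_rpow (h.pos s).le (hM s hs) (by linarith)
    have h3 : ℓ ^ (p - 1) * v s ≤ ℓ ^ (p - 1) * M :=
      mul_le_mul_of_nonneg_left (hM s hs) (by positivity)
    have h4 : 0 < v s ^ p := Real.rpow_pos_of_pos (h.pos s) _
    have h5 : 0 < ℓ ^ (p - 1) * v s := mul_pos (by positivity) (h.pos s)
    rw [abs_le] at h1
    rw [Real.norm_eq_abs, abs_le]
    constructor <;> linarith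
  have hlip : ∀ x ≤ s₀, ∀ y ≤ s₀, |v' y - v' x| ≤ K * |y - x| := fun x hx y hy =>
    (convex_Iic s₀).norm_image_sub_le_of_norm_hasDerivWithin_le
      (fun s _ => (h.hasDerivAt' s).hasDerivWithinAt) hK hx hy
  have hzero : ∀ t, ∃ s ≤ t, v s = ℓ := by
    intro t
    obtain ⟨x, hx, hxl⟩ := hlt t
    obtain ⟨y, hy, hyl⟩ := hgt x
    obtain ⟨s, hs, hsl⟩ := intermediate_value_Icc' hy h.continuous.continuousOn ⟨hxl.le, hyl.le⟩
    exact ⟨s, hs.2.trans hx, hsl⟩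
  obtain ⟨x, hx, hx0, hxl⟩ := h.exists_critical_lt hlt hgt s₀
  have hEx : potential p ℓ ℓ < E x := by
    simpa [hEdef, hx0] using potential_lt hp hℓ (h.pos x) hxl.ne
  set η := E x - potential p ℓ ℓ with hη
  have hη0 : 0 < η := by linarith
  -- At each crossing `s ≤ x` the speed is at least `μ`. As `v'` is `K`-Lipschitz, it stays at least
  -- `μ / 2` for a time `d`, during which the energy drops by at least `D`.
  set μ := √η with hμ
  have hμ0 : 0 < μ := Real.sqrt_pos.2 hη0
  set d := μ / (2 * K) with hd
  have hd0 : 0 < d := by positivity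
  have hKd : K * d = μ / 2 := by rw [hd]; field_simp
  set D := c * (μ / 2) ^ 2 * d with hD
  have hD0 : 0 < D := by positivity
  have hbdd : BddAbove (E '' Iic x) :=
    ⟨0, by rintro _ ⟨s, hs, rfl⟩; exact (hEneg s (le_trans hs hx)).le⟩
  -- The energy at `t` is within `D` of its supremum; a crossing before `t - d` would have energy at
  -- least `E t + D`, exceeding that supremum.
  obtain ⟨_, ⟨t, ht, rfl⟩, htD⟩ := exists_lt_of_lt_csSup (⟨E x, x, mem_Iic.2 le_rfl, rfl⟩ :
    (E '' Iic x).Nonempty) (sub_lt_self (sSup (E '' Iic x)) hD0)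
  obtain ⟨s, hs, hsl⟩ := hzero (t - d)
  have htx : t ≤ x := ht
  have hsx : s ≤ x := by linarith
  have hsup : E s ≤ sSup (E '' Iic x) := le_csSup hbdd ⟨s, hsx, rfl⟩
  have hvs : μ ≤ |v' s| := by
    have h1 : E x ≤ E s := hE (hsx.trans hx) hx hsx
    have h2 : E s = v' s ^ 2 / 2 + potential p ℓ ℓ := by simp only [hEdef, hsl]
    exact Real.sqrt_le_iff.2 ⟨abs_nonneg _, by rw [sq_abs]; linarith [sq_nonneg (v' s)]⟩
  have hanti : AntitoneOn (fun r => E r + c * (μ / 2) ^ 2 * r) (Icc s (s + d)) := by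
    refine antitoneOn_of_hasDerivAt_nonpos (convex_Icc _ _)
      (fun r => (hE' r).add ((hasDerivAt_id r).const_mul (c * (μ / 2) ^ 2))) fun r hr => ?_
    have hr0 : r ≤ s₀ := by linarith [hr.2]
    have h1 := hlip s (hsx.trans hx) r hr0
    have h2 : K * |r - s| ≤ μ / 2 := by
      rw [← hKd, abs_of_nonneg (by linarith [hr.1])]
      exact mul_le_mul_of_nonneg_left (by linarith [hr.2]) hK0.le
    have h3 : |v' s| - |v' r| ≤ |v' s - v' r| := abs_sub_abs_le_abs_sub _ _
    rw [abs_sub_comm] at h3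
    have h4 : (μ / 2) ^ 2 ≤ v' r ^ 2 := by
      rw [← sq_abs (v' r)]
      exact pow_le_pow_left₀ (by positivity) (by linarith) 2
    have h5 := mul_le_mul (hbc r hr0) h4 (by positivity) (hc.le.trans (hbc r hr0))
    linarith
  have h1 : E (s + d) + c * (μ / 2) ^ 2 * (s + d) ≤ E s + c * (μ / 2) ^ 2 * s :=
    hanti ⟨le_rfl, by linarith⟩ ⟨by linarith, le_rfl⟩ (by linarith)
  have h2 : E t ≤ E (s + d) := hE (show s + d ≤ s₀ by linarith) (htx.trans hx) (by linarith)
  have h3 : c * (μ / 2) ^ 2 * (s + d) = c * (μ / 2) ^ 2 * s + D := by rw [hD]; ring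
  linarith

/-- An orbit which is at equilibrium near `-∞` stays there. -/
theorem eq_of_eq_near_bot (h : IsPosOrbit p ℓ (fun _ => 1) b v v') (hp : 1 < p) (hℓ : 0 < ℓ)
    (hb : Continuous b) (hv : ∀ s ≤ s₀, v s = ℓ) (s : ℝ) : v s = ℓ := by
  rcases le_total s s₀ with hs | hs
  · exact hv s hs
  set t := s₀ - 1 with ht
  have hts : t ≤ s := by linarith
  have hvt : v t = ℓ := hv t (by linarith)
  have hvt' : v' t = 0 := by
    have h1 : v =ᶠ[𝓝 t] fun _ => ℓ := by
      filter_upwards [Iic_mem_nhds (show t < s₀ by linarith)] with x hx using hv x hx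
    simpa [(h.hasDerivAt t).deriv] using h1.deriv_eq
  obtain ⟨B, hB⟩ := (isCompact_Icc (a := t) (b := s)).exists_bound_of_continuousOn hb.continuousOn
  -- Gronwall: with `|b| ≤ B`, the energy excess over the minimum grows at rate at most `2B`. It
  -- vanishes at `t`, hence at `s`.
  have hanti : AntitoneOn (fun x => (v' x ^ 2 / 2 + potential p ℓ (v x) - potential p ℓ ℓ)
      * Real.exp (-(2 * B) * x)) (Icc t s) := by
    refine antitoneOn_of_hasDerivAt_nonpos (convex_Icc _ _)
      (fun x => ((h.hasDerivAt_energy_one hp x).sub_const _).mul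
        ((hasDerivAt_id x).const_mul (-(2 * B))).exp) fun x hx => ?_
    have h1 := hB x hx
    have hB0 : 0 ≤ B := (norm_nonneg _).trans h1
    have h2 := (abs_le.1 h1).1
    have h3 := potential_le hp hℓ (h.pos x)
    have h4 : -(b x * v' x ^ 2) + (v' x ^ 2 / 2 + potential p ℓ (v x) - potential p ℓ ℓ)
        * -(2 * B) ≤ 0 := by
      nlinarith [mul_nonneg (sub_nonneg.2 h2) (sq_nonneg (v' x)),
        mul_nonneg hB0 (sub_nonneg.2 h3)]
    have h5 := mul_nonpos_of_nonpos_of_nonneg h4 (Real.exp_pos (-(2 * B) * x)).le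
    simp only [id]
    linarith
  have h1 := hanti ⟨le_rfl, hts⟩ ⟨hts, le_rfl⟩ hts
  simp only [hvt, hvt'] at h1
  have h2 : v' s ^ 2 / 2 + potential p ℓ (v s) - potential p ℓ ℓ ≤ 0 := by
    by_contra! hc
    have := mul_pos hc (Real.exp_pos (-(2 * B) * s))
    norm_num at h1
    rw [neg_mul] at this
    linarith
  by_contra hne
  nlinarith [potential_lt hp hℓ (h.pos s) hne, sq_nonneg (v' s)]

/-- With `D` chosen to give equality at `s₀`, the difference `v - D φ` is strictly convex at any
critical point where it is positive, so the maximum principle applies. -/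
theorem exists_le_mul_of_supersolution (h : IsPosOrbit p ℓ (fun _ => 1) b v v')
    (hv : Tendsto v atBot (𝓝 0)) {φ φ' φ'' : ℝ → ℝ} (hφ : ∀ s, HasDerivAt φ (φ' s) s)
    (hφ' : ∀ s, HasDerivAt φ' (φ'' s) s) (hlim : Tendsto φ atBot (𝓝 0)) (hφ0 : 0 < φ s₀)
    (hsmall : ∀ s ≤ s₀, v s ^ (p - 1) < ℓ ^ (p - 1))
    (hsuper : ∀ s ≤ s₀, φ'' s + b s * φ' s - (ℓ ^ (p - 1) - v s ^ (p - 1)) * φ s ≤ 0) :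
    ∃ D, 0 < D ∧ ∀ s ≤ s₀, v s ≤ D * φ s := by
  have hD : 0 < v s₀ / φ s₀ := div_pos (h.pos s₀) hφ0
  refine ⟨v s₀ / φ s₀, hD, fun s hs => sub_nonpos.1 ?_⟩
  revert s
  set D := v s₀ / φ s₀ with hDdef
  refine nonpos_of_strictConvex_at_pos_critical (u := fun s => v s - D * φ s)
    (fun s => (h.hasDerivAt s).sub ((hφ s).const_mul D))
    (fun s => (h.hasDerivAt' s).sub ((hφ' s).const_mul D)) ?_ ?_ fun s hs hpos hcrit => ?_
  · rw [hDdef, div_mul_cancel₀ _ hφ0.ne', sub_self]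
  · simpa using hv.sub (hlim.const_mul D)
  · have h1 := hsuper s hs
    have h2 := mul_pos (sub_pos.2 (hsmall s hs)) hpos
    have h3 : v s ^ p - ℓ ^ (p - 1) * v s = v s * (v s ^ (p - 1) - ℓ ^ (p - 1)) :=
      rpow_sub_mul_eq (h.pos s)
    have h4 : v' s = D * φ' s := sub_eq_zero.1 hcrit
    have h5 := mul_nonpos_of_nonneg_of_nonpos hD.le h1
    rw [h3, h4]
    linarith

/-- A positive orbit tending to `0` at `-∞` decays at the rate of the unstable eigenvalue. -/
theorem exists_le_exp_of_tendsto_zero (h : IsPosOrbit p ℓ (fun _ => 1) b v v') {m β : ℝ}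
    (hp : 1 < p) (hm : m * (p - 1) = 2) (hβ : 0 ≤ β) (hℓ : ℓ ^ (p - 1) = m * (m + β))
    (hb : ∀ s ≤ 0, |b s - β| ≤ Real.exp s) (hv : Tendsto v atBot (𝓝 0)) :
    ∃ D s₁, 0 < D ∧ ∀ s ≤ s₁, v s ≤ D * Real.exp (m * s) := by
  have hp1 : 0 < p - 1 := by linarith
  have hm0 : 0 < m := by
    by_contra! hc
    nlinarith
  have hexp : ∀ x : ℝ, ∀ s, HasDerivAt (fun s => Real.exp (x * s)) (x * Real.exp (x * s)) s :=
    fun x s => (((hasDerivAt_id s).const_mul x).exp).congr_deriv (by simp [mul_comm])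
  have hexplim : ∀ x : ℝ, 0 < x → Tendsto (fun s => Real.exp (x * s)) atBot (𝓝 0) := fun x hx =>
    Real.tendsto_exp_atBot.comp (tendsto_id.const_mul_atBot hx)
  have hvp : Tendsto (fun s => v s ^ (p - 1)) atBot (𝓝 0) := by
    simpa [Real.zero_rpow hp1.ne'] using hv.rpow_const (p := p - 1) (Or.inr hp1.le)
  have hbβ : Tendsto b atBot (𝓝 β) := by
    rw [← tendsto_sub_nhds_zero_iff]
    refine squeeze_zero_norm' ?_ Real.tendsto_exp_atBot
    filter_upwards [eventually_le_atBot 0] with s hs using hb s hs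
  have hℓ0 : 0 < ℓ ^ (p - 1) := by rw [hℓ]; positivity
  have hev1 : ∀ᶠ s in atBot, v s ^ (p - 1) < ℓ ^ (p - 1) := (tendsto_order.1 hvp).2 _ hℓ0
  have hev2 : ∀ᶠ s in atBot, (m / 2) * (m / 2) + b s * (m / 2)
      - (ℓ ^ (p - 1) - v s ^ (p - 1)) < 0 := by
    have ht : Tendsto (fun s => (m / 2) * (m / 2) + b s * (m / 2)
        - (ℓ ^ (p - 1) - v s ^ (p - 1))) atBot
        (𝓝 ((m / 2) * (m / 2) + β * (m / 2) - (ℓ ^ (p - 1) - 0))) :=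
      ((hbβ.mul_const _).const_add _).sub (hvp.const_sub _)
    exact (tendsto_order.1 ht).2 _ (by rw [hℓ]; nlinarith)
  obtain ⟨s₀, hs₀⟩ := eventually_atBot.1 (hev1.and hev2)
  -- First a rough bound at half the true rate. Since `(m/2)(p-1) = 1`, it makes `v^(p-1)` of order
  -- `e^s`.
  obtain ⟨C, hC0, hC⟩ := h.exists_le_mul_of_supersolution hv (s₀ := s₀) (hexp (m / 2))
    (fun s => (hexp (m / 2) s).const_mul (m / 2)) (hexplim _ (by positivity)) (Real.exp_pos _)
    (fun s hs => (hs₀ s hs).1) (fun s hs => by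
      have := mul_nonpos_of_nonpos_of_nonneg (hs₀ s hs).2.le (Real.exp_pos (m / 2 * s)).le
      linarith)
  have hvp' : ∀ s ≤ s₀, v s ^ (p - 1) ≤ C ^ (p - 1) * Real.exp s := by
    intro s hs
    refine (Real.rpow_le_rpow (h.pos s).le (hC s hs) hp1.le).trans_eq ?_
    rw [Real.mul_rpow hC0.le (Real.exp_pos _).le, ← Real.exp_mul]
    congr 2
    linear_combination s / 2 * hm
  -- `A e^s` dominates the total error `(b - β) m + v^(p-1)`. The rate `m` is a root of `λ² + βλ -
  -- m(m + β)`, and this polynomial is positive at `m + 1`, so subtracting `A e^{(m+1)s}` from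
  -- `e^{ms}` yields a supersolution at the sharp rate.
  set A := m + C ^ (p - 1) with hA
  have hA0 : 0 < A := by positivity
  have hev3 : ∀ᶠ s in atBot, A * Real.exp s < 1 ∧ (m + 1) * Real.exp s < m := by
    have h1 : Tendsto (fun s => A * Real.exp s) atBot (𝓝 0) := by
      simpa using Real.tendsto_exp_atBot.const_mul A
    have h2 : Tendsto (fun s => (m + 1) * Real.exp s) atBot (𝓝 0) := by
      simpa using Real.tendsto_exp_atBot.const_mul (m + 1)
    exact ((tendsto_order.1 h1).2 _ one_pos).and ((tendsto_order.1 h2).2 _ hm0)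
  obtain ⟨s₁, hs₁⟩ := eventually_atBot.1
    ((eventually_le_atBot s₀).and ((eventually_le_atBot 0).and hev3))
  have hsplit : ∀ s, Real.exp ((m + 1) * s) = Real.exp (m * s) * Real.exp s := fun s => by
    rw [← Real.exp_add]; ring_nf
  obtain ⟨D, hD0, hD⟩ := h.exists_le_mul_of_supersolution hv (s₀ := s₁)
    (φ := fun s => Real.exp (m * s) - A * Real.exp ((m + 1) * s))
    (fun s => (hexp m s).sub ((hexp (m + 1) s).const_mul A))
    (fun s => ((hexp m s).const_mul m).sub (((hexp (m + 1) s).const_mul (m + 1)).const_mul A))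
    (by simpa using (hexplim m hm0).sub ((hexplim (m + 1) (by positivity)).const_mul A))
    (by
      have h1 := (hs₁ s₁ le_rfl).2.2.1
      have h2 := Real.exp_pos (m * s₁)
      simp only [hsplit]
      nlinarith)
    (fun s hs => (hs₀ s (hs₁ s hs).1).1)
    (fun s hs => by
      obtain ⟨hss₀, hs0, -, hsm⟩ := hs₁ s hs
      have h1 := abs_le.1 (hb s hs0)
      have h2 := hvp' s hss₀
      have h3 := Real.exp_pos s
      have h6 : 0 < v s ^ (p - 1) := Real.rpow_pos_of_pos (h.pos s) _
      simp only [hsplit, hℓ]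
      have h4 : (b s - β) * m + v s ^ (p - 1) ≤ A * Real.exp s := by
        rw [hA]
        nlinarith [mul_le_mul_of_nonneg_right h1.2 hm0.le]
      have h5 : 1 ≤ (m + 1) ^ 2 + b s * (m + 1) - m * (m + β) + v s ^ (p - 1) := by
        nlinarith [mul_le_mul_of_nonneg_right h1.1 (show 0 ≤ m + 1 by linarith)]
      have h7 : (b s - β) * m + v s ^ (p - 1) - A * Real.exp s
          * ((m + 1) ^ 2 + b s * (m + 1) - m * (m + β) + v s ^ (p - 1)) ≤ 0 := by
        have := mul_le_mul_of_nonneg_left h5 (mul_pos hA0 h3).le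
        linarith
      have h8 := mul_nonpos_of_nonneg_of_nonpos (Real.exp_pos (m * s)).le h7
      linarith)
  refine ⟨D, s₁, hD0, fun s hs => (hD s hs).trans ?_⟩
  refine mul_le_mul_of_nonneg_left ?_ hD0.le
  have := mul_pos hA0 (Real.exp_pos ((m + 1) * s))
  linarith

end IsPosOrbit

/-! ### Self-similar solutions: exponents, bounds and sign changes. -/

/-- `w` solves the forward (`σ = 1`) or backward (`σ = -1`) self-similar equation. -/
structure IsSelfSimilarSolution (σ : ℝ) (n : ℕ) (p : ℝ) (w : ℝ → ℝ) : Prop where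
  diff : TwiceDifferentiableOnPos w
  pos : ∀ r : ℝ, 0 < r → 0 < w r
  eqn : ∀ r : ℝ, 0 < r → deriv (deriv w) r + (((n : ℝ) - 1) / r + σ * (r / 2)) * deriv w r
    + σ * (1 / (p - 1) * w r) + w r ^ p = 0

section Exponents

variable {n : ℕ} {p : ℝ}

theorem one_lt_of_sobolevExponent_le (hn : 2 < n) (hp : sobolevExponent n ≤ p) : 1 < p := by
  have hn' : (2 : ℝ) < n := by exact_mod_cast hn
  refine lt_of_lt_of_le ?_ hp
  rw [sobolevExponent, lt_div_iff₀ (by linarith)]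
  linarith

theorem damping_eq (hp : 1 < p) :
    (n : ℝ) - 2 - 2 * (2 / (p - 1)) = (((n : ℝ) - 2) * p - ((n : ℝ) + 2)) / (p - 1) := by
  have : p - 1 ≠ 0 := by linarith
  field_simp
  ring

theorem damping_nonneg (hn : 2 < n) (hp : sobolevExponent n ≤ p) :
    0 ≤ (n : ℝ) - 2 - 2 * (2 / (p - 1)) := by
  have hn' : (2 : ℝ) < n := by exact_mod_cast hn
  have hp1 := one_lt_of_sobolevExponent_le hn hp
  rw [damping_eq hp1]
  rw [sobolevExponent, div_le_iff₀ (by linarith)] at hp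
  exact div_nonneg (by linarith) (by linarith)

theorem damping_pos (hn : 2 < n) (hp : sobolevExponent n < p) :
    0 < (n : ℝ) - 2 - 2 * (2 / (p - 1)) := by
  have hn' : (2 : ℝ) < n := by exact_mod_cast hn
  have hp1 := one_lt_of_sobolevExponent_le hn hp.le
  rw [damping_eq hp1]
  rw [sobolevExponent, div_lt_iff₀ (by linarith)] at hp
  exact div_pos (by linarith) (by linarith)

theorem singularConstant_base_eq (hp : 1 < p) :
    2 / (p - 1) ^ 2 * (((n : ℝ) - 2) * p - n)
      = 2 / (p - 1) * (2 / (p - 1) + ((n : ℝ) - 2 - 2 * (2 / (p - 1)))) := by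
  have : p - 1 ≠ 0 := by linarith
  field_simp
  ring

theorem singularConstant_base_pos (hn : 2 < n) (hp : sobolevExponent n ≤ p) :
    0 < 2 / (p - 1) ^ 2 * (((n : ℝ) - 2) * p - n) := by
  have hp1 := one_lt_of_sobolevExponent_le hn hp
  have h1 := damping_nonneg hn hp
  have h2 : 0 < 2 / (p - 1) := div_pos two_pos (by linarith)
  rw [singularConstant_base_eq hp1]
  exact mul_pos h2 (by linarith)

theorem singularConstant_pos (hn : 2 < n) (hp : sobolevExponent n ≤ p) :
    0 < singularConstant n p :=
  Real.rpow_pos_of_pos (singularConstant_base_pos hn hp) _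

theorem singularConstant_rpow (hn : 2 < n) (hp : sobolevExponent n ≤ p) :
    singularConstant n p ^ (p - 1)
      = 2 / (p - 1) * (2 / (p - 1) + ((n : ℝ) - 2 - 2 * (2 / (p - 1)))) := by
  have hp1 := one_lt_of_sobolevExponent_le hn hp
  have : p - 1 ≠ 0 := by linarith
  rw [singularConstant, ← Real.rpow_mul (singularConstant_base_pos hn hp).le,
    one_div_mul_cancel this, Real.rpow_one, singularConstant_base_eq hp1]

theorem singularSolution_exp (n : ℕ) (p s : ℝ) :
    singularSolution n p (Real.exp s)
      = singularConstant n p * Real.exp (-(2 / (p - 1) * s)) := by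
  rw [singularSolution, ← Real.exp_mul]
  congr 2
  ring

end Exponents

theorem isBounded_of_bounded_near_ends {w : ℝ → ℝ} (hw : ContinuousOn w (Ioi 0))
    (hpos : ∀ r : ℝ, 0 < r → 0 < w r) (h0 : ∃ M s₀, ∀ s ≤ s₀, w (Real.exp s) ≤ M)
    (h1 : ∃ M s₁, ∀ s ≥ s₁, w (Real.exp s) ≤ M) :
    Bornology.IsBounded (w '' Ioi (0 : ℝ)) := by
  obtain ⟨M₀, s₀, h0⟩ := h0
  obtain ⟨M₁, s₁, h1⟩ := h1
  have hc : ContinuousOn (fun s => w (Real.exp s)) (Icc s₀ s₁) :=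
    hw.comp Real.continuous_exp.continuousOn fun s _ => Real.exp_pos s
  obtain ⟨M₂, h2⟩ := isCompact_Icc.exists_bound_of_continuousOn hc
  refine isBounded_iff_forall_norm_le.2 ⟨max M₀ (max M₁ M₂), ?_⟩
  rintro _ ⟨r, hr, rfl⟩
  have hr0 : (0 : ℝ) < r := hr
  rw [Real.norm_eq_abs, abs_of_pos (hpos r hr0), ← Real.exp_log hr0]
  rcases le_total (Real.log r) s₀ with h | h
  · exact (h0 _ h).trans (le_max_left _ _)
  rcases le_total s₁ (Real.log r) with h' | h'
  · exact (h1 _ h').trans ((le_max_left _ _).trans (le_max_right _ _))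
  · exact ((le_abs_self _).trans (h2 _ ⟨h, h'⟩)).trans
      ((le_max_right _ _).trans (le_max_right _ _))

/-- A function alternating in sign near `0` has infinitely many sign changes. -/
theorem signChangeNumber_eq_top {f : ℝ → ℝ} (hneg : ∀ t, ∃ s ≤ t, f (Real.exp s) < 0)
    (hpos : ∀ t, ∃ s ≤ t, 0 < f (Real.exp s)) : signChangeNumber f (Ioi 0) = ⊤ := by
  have hstep : ∀ t : {t : ℝ // f (Real.exp t) ≠ 0}, ∃ t' : {t : ℝ // f (Real.exp t) ≠ 0},
      t'.1 < t.1 ∧ f (Real.exp t'.1) * f (Real.exp t.1) < 0 := by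
    rintro ⟨t, ht⟩
    rcases lt_or_gt_of_ne ht with h | h
    · obtain ⟨s, hs, hfs⟩ := hpos (t - 1)
      exact ⟨⟨s, hfs.ne'⟩, by simp only; linarith, mul_neg_of_pos_of_neg hfs h⟩
    · obtain ⟨s, hs, hfs⟩ := hneg (t - 1)
      exact ⟨⟨s, hfs.ne⟩, by simp only; linarith, mul_neg_of_neg_of_pos hfs h⟩
  choose next hnext using hstep
  obtain ⟨t₀, -, ht₀⟩ := hneg 0
  set y : ℕ → {t : ℝ // f (Real.exp t) ≠ 0} := fun k => next^[k] ⟨t₀, ht₀.ne⟩ with hy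
  have hy' : ∀ k, (y (k + 1)).1 < (y k).1 ∧
      f (Real.exp (y (k + 1)).1) * f (Real.exp (y k).1) < 0 := by
    intro k
    simp only [hy, Function.iterate_succ_apply']
    exact hnext _
  have hanti : StrictAnti fun k => (y k).1 := strictAnti_nat_of_succ_lt fun k => (hy' k).1
  -- The alternating points decrease towards `-∞`, so they are listed in reverse as `k - i`.
  refine ENat.eq_top_iff_forall_ge.2 fun k => le_sSup ⟨k, rfl,
    fun i => Real.exp (y (k - i)).1, ?_, fun i => Real.exp_pos _, fun i => ?_⟩
  · intro i j hij
    refine Real.exp_lt_exp.2 (hanti ?_)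
    have := j.2
    have : (i : ℕ) < j := hij
    omega
  · have h1 : k - (i.castSucc : ℕ) = (k - (i.succ : ℕ)) + 1 := by
      have := i.2
      simp only [Fin.val_castSucc, Fin.val_succ]
      omega
    simp only [h1]
    exact (hy' _).2

/-! ### Changes of variable, behaviour at infinity, and the conclusion. -/

namespace IsSelfSimilarSolution

variable {σ p : ℝ} {n : ℕ} {w : ℝ → ℝ}

/-- The Emden–Fowler transform of a self-similar solution. -/
theorem isPosOrbit_emdenFowler (h : IsSelfSimilarSolution σ n p w) (hn : 2 < n)
    (hp : sobolevExponent n ≤ p) :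
    IsPosOrbit p (singularConstant n p) (fun _ => 1)
      (fun s => ((n : ℝ) - 2 - 2 * (2 / (p - 1))) + σ / 2 * Real.exp (2 * s))
      (fun s => Real.exp (2 / (p - 1) * s) * w (Real.exp s))
      (fun s => Real.exp (2 / (p - 1) * s) *
        (2 / (p - 1) * w (Real.exp s) + Real.exp s * deriv w (Real.exp s))) := by
  have hp1 := one_lt_of_sobolevExponent_le hn hp
  have hL := singularConstant_rpow hn hp
  have hmp : 2 / (p - 1) * p = 2 / (p - 1) + 2 := by
    have : p - 1 ≠ 0 := by linarith
    field_simp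
    ring
  have hm2 : 1 / (p - 1) = 2 / (p - 1) / 2 := by ring
  have hexp : ∀ s, HasDerivAt (fun s => Real.exp (2 / (p - 1) * s))
      (Real.exp (2 / (p - 1) * s) * (2 / (p - 1))) s :=
    fun s => (((hasDerivAt_id s).const_mul (2 / (p - 1))).exp).congr_deriv (by simp)
  have hw : ∀ s, HasDerivAt (fun s => w (Real.exp s)) (deriv w (Real.exp s) * Real.exp s) s :=
    fun s => (h.diff.1 _ (Real.exp_pos s)).hasDerivAt.comp s (Real.hasDerivAt_exp s)
  have hw' : ∀ s, HasDerivAt (fun s => deriv w (Real.exp s))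
      (deriv (deriv w) (Real.exp s) * Real.exp s) s :=
    fun s => (h.diff.2 _ (Real.exp_pos s)).hasDerivAt.comp s (Real.hasDerivAt_exp s)
  refine ⟨fun s => mul_pos (Real.exp_pos _) (h.pos _ (Real.exp_pos s)),
    fun s => ((hexp s).mul (hw s)).congr_deriv (by ring), fun s => ?_⟩
  refine ((hexp s).mul (((hw s).const_mul (2 / (p - 1))).add
    ((Real.hasDerivAt_exp s).mul (hw' s)))).congr_deriv ?_
  have hr := Real.exp_pos s
  have heq := h.eqn _ hr
  rw [hL, Real.mul_rpow (Real.exp_pos _).le (h.pos _ hr).le, ← Real.exp_mul,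
    show 2 / (p - 1) * s * p = 2 / (p - 1) * s + 2 * s by linear_combination s * hmp,
    Real.exp_add, show Real.exp (2 * s) = Real.exp s ^ 2 by rw [← Real.exp_nat_mul]; norm_num]
  rw [hm2] at heq
  simp only [Pi.add_apply, Pi.mul_apply]
  generalize 2 / (p - 1) = m at *
  generalize Real.exp (m * s) = X
  generalize Real.exp s = r at *
  have heq' : deriv (deriv w) r * r ^ 2 + (((n : ℝ) - 1) * r + σ * (r ^ 3 / 2)) * deriv w r
      + σ * (m / 2 * w r) * r ^ 2 + w r ^ p * r ^ 2 = 0 := by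
    have h0 : ((n : ℝ) - 1) / r * r ^ 2 = ((n : ℝ) - 1) * r := by field_simp
    linear_combination r ^ 2 * heq - deriv w r * h0
  linear_combination X * heq'

/-- The solution in the variable `t = -log r`. -/
theorem isPosOrbit_reverse (h : IsSelfSimilarSolution (-1) n p w) (hp : 1 < p) :
    IsPosOrbit p ((1 / (p - 1)) ^ (1 / (p - 1))) (fun t => Real.exp (-(2 * t)))
      (fun t => Real.exp (-(2 * t)) / 2 - ((n : ℝ) - 2))
      (fun t => w (Real.exp (-t)))
      (fun t => -(Real.exp (-t) * deriv w (Real.exp (-t)))) := by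
  have hp1 : 0 < p - 1 := by linarith
  have hκ : ((1 / (p - 1)) ^ (1 / (p - 1))) ^ (p - 1) = 1 / (p - 1) := by
    rw [← Real.rpow_mul (by positivity), one_div_mul_cancel hp1.ne', Real.rpow_one]
  have hexp : ∀ t, HasDerivAt (fun t => Real.exp (-t)) (-Real.exp (-t)) t :=
    fun t => ((hasDerivAt_neg t).exp).congr_deriv (by simp)
  refine ⟨fun t => h.pos _ (Real.exp_pos _), fun t => ?_, fun t => ?_⟩
  · exact ((h.diff.1 _ (Real.exp_pos (-t))).hasDerivAt.comp t (hexp t)).congr_deriv (by ring)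
  · refine ((hexp t).mul
      ((h.diff.2 _ (Real.exp_pos (-t))).hasDerivAt.comp t (hexp t))).neg.congr_deriv ?_
    have hr := Real.exp_pos (-t)
    have heq := h.eqn _ hr
    rw [hκ, show Real.exp (-(2 * t)) = Real.exp (-t) ^ 2 by
      rw [← Real.exp_nat_mul]; push_cast; ring_nf]
    simp only [Function.comp_apply]
    generalize Real.exp (-t) = r at *
    have h0 : ((n : ℝ) - 1) / r * r ^ 2 = ((n : ℝ) - 1) * r := by field_simp
    linear_combination r ^ 2 * heq - deriv w r * h0

/-- For `s ≤ 0` the perturbation of `β` is at most `1/2`, so the constant damping `β + 1` dominates;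
it is positive even when `β = 0`, which makes `Q` vanish at `-∞`. -/
theorem isWeightPair_emdenFowler (hσ : |σ| ≤ 1) {β : ℝ} (hβ : 0 ≤ β) {s₀ : ℝ} (hs₀ : s₀ ≤ 0) :
    IsWeightPair (fun _ => 1) (fun s => β + σ / 2 * Real.exp (2 * s)) (fun _ => β + 1)
      (fun s => Real.exp (β * s + σ / 4 * Real.exp (2 * s))) (fun s => Real.exp ((β + 1) * s))
      (1 / (β + 1)) (Real.exp (1 / 4)) s₀ where
  c_pos := by positivity
  P_pos s := Real.exp_pos _
  P_deriv s := by
    have h1 : HasDerivAt (fun s => Real.exp (2 * s)) (Real.exp (2 * s) * 2) s :=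
      (((hasDerivAt_id s).const_mul 2).exp).congr_deriv (by simp)
    exact ((((hasDerivAt_id s).const_mul β).add (h1.const_mul (σ / 4))).exp).congr_deriv
      (by simp only [id, Pi.add_apply]; ring)
  P_le s hs := by
    have h1 : Real.exp (2 * s) ≤ 1 := Real.exp_le_one_iff.2 (by linarith)
    have h2 := Real.exp_pos (2 * s)
    have h3 := (abs_le.1 hσ).2
    exact Real.exp_le_exp.2 (by nlinarith)
  Q_pos s := Real.exp_pos _
  Q_deriv s := (((hasDerivAt_id s).const_mul (β + 1)).exp).congr_deriv (by simp [mul_comm])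
  Q_lim := Real.tendsto_exp_atBot.comp (tendsto_id.const_mul_atBot (by positivity))
  a_nonneg _ := zero_le_one
  b_le s hs := by
    have h1 : Real.exp (2 * s) ≤ 1 := Real.exp_le_one_iff.2 (by linarith)
    have h2 := Real.exp_pos (2 * s)
    have h3 := (abs_le.1 hσ).2
    nlinarith
  q_le s _ := by
    have : β + 1 ≠ 0 := by positivity
    simp [this]

/-- The damping is unbounded at `-∞`, but so is `a`, and `q = a / 2` gives `c = 2`. The weight `P`
is increasing up to `s₀`, hence bounded by its value there. -/
theorem isWeightPair_reverse {d s₀ : ℝ} (hd : 0 ≤ d) (hs₀ : ∀ t ≤ s₀, d ≤ Real.exp (-(2 * t)) / 2) :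
    IsWeightPair (fun t => Real.exp (-(2 * t))) (fun t => Real.exp (-(2 * t)) / 2 - d)
      (fun t => Real.exp (-(2 * t)) / 2)
      (fun t => Real.exp (-(d * t) - Real.exp (-(2 * t)) / 4))
      (fun t => Real.exp (-(Real.exp (-(2 * t)) / 4)))
      2 (Real.exp (-(d * s₀) - Real.exp (-(2 * s₀)) / 4)) s₀ := by
  have h1 : ∀ t, HasDerivAt (fun t => Real.exp (-(2 * t))) (-(2 * Real.exp (-(2 * t)))) t :=
    fun t => ((((hasDerivAt_id t).const_mul 2).neg).exp).congr_deriv (by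
      simp only [id, Pi.neg_apply]; ring)
  have hP : ∀ t, HasDerivAt (fun t => Real.exp (-(d * t) - Real.exp (-(2 * t)) / 4))
      ((Real.exp (-(2 * t)) / 2 - d) * Real.exp (-(d * t) - Real.exp (-(2 * t)) / 4)) t :=
    fun t => ((((hasDerivAt_id t).const_mul d).neg.sub ((h1 t).div_const 4)).exp).congr_deriv (by
      simp only [id, Pi.neg_apply, Pi.sub_apply]; ring)
  refine ⟨two_pos, fun t => Real.exp_pos _, hP, fun t ht => ?_, fun t => Real.exp_pos _,
    fun t => ?_, ?_, fun t => (Real.exp_pos _).le, fun t _ => by linarith, fun t _ => by linarith⟩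
  · exact monotoneOn_of_hasDerivAt_nonneg (convex_Iic s₀) hP
      (fun s hs => mul_nonneg (sub_nonneg.2 (hs₀ s hs)) (Real.exp_pos _).le) ht
      (mem_Iic.2 le_rfl) ht
  · exact (((h1 t).div_const 4).neg.exp).congr_deriv (by simp only [Pi.neg_apply]; ring)
  · refine Real.tendsto_exp_neg_atTop_nhds_zero.comp (Tendsto.atTop_div_const (by norm_num) ?_)
    refine Real.tendsto_exp_atTop.comp (tendsto_neg_atBot_atTop.comp ?_)
    exact tendsto_id.const_mul_atBot two_pos

theorem bounded_at_top_forward (h : IsSelfSimilarSolution 1 n p w) (hn : 2 < n)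
    (hp : sobolevExponent n ≤ p) : ∃ M s₁, ∀ s ≥ s₁, w (Real.exp s) ≤ M := by
  have hp1 := one_lt_of_sobolevExponent_le hn hp
  have hβ := damping_nonneg hn hp
  have ho := h.isPosOrbit_emdenFowler hn hp
  have hE := antitoneOn_of_hasDerivAt_nonpos convex_univ (ho.hasDerivAt_energy_one hp1)
    fun s _ => neg_nonpos.2 (mul_nonneg (add_nonneg hβ (by positivity)) (sq_nonneg _))
  obtain ⟨M, hM⟩ := exists_bound_of_potential_le hp1 (singularConstant n p) _
  refine ⟨M, 0, fun s hs => le_trans ?_ (hM _ (ho.pos s)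
    (le_trans (le_add_of_nonneg_left (by positivity)) (hE (mem_univ 0) (mem_univ s) hs)))⟩
  -- For `s ≥ 0` the factor `e^{ms}` is at least `1`, so the bound on `v` passes to `w`.
  refine le_mul_of_one_le_left (h.pos _ (Real.exp_pos s)).le (Real.one_le_exp ?_)
  exact mul_nonneg (div_nonneg zero_le_two (by linarith)) hs

theorem bounded_at_top_backward (h : IsSelfSimilarSolution (-1) n p w) (hn : 2 < n)
    (hp : 1 < p) : ∃ M s₁, ∀ s ≥ s₁, w (Real.exp s) ≤ M := by
  have hn' : (2 : ℝ) < n := by exact_mod_cast hn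
  have hp1 : 0 < p - 1 := by linarith
  have ho := h.isPosOrbit_reverse hp
  have hκ : 0 < (1 / (p - 1)) ^ (1 / (p - 1)) := by positivity
  set κ := (1 / (p - 1)) ^ (1 / (p - 1))
  suffices ∃ M t₁, ∀ t ≤ t₁, w (Real.exp (-t)) ≤ M by
    obtain ⟨M, t₁, ht⟩ := this
    exact ⟨M, -t₁, fun s hs => by simpa using ht (-s) (by linarith)⟩
  -- The threshold is `n - 1` rather than `n - 2` because the energy's dissipation involves `b +
  -- a'/(2a)`, and `a'/(2a) = -1`.
  obtain ⟨s₀, hs₀⟩ : ∃ s₀ : ℝ, ∀ t ≤ s₀, (n : ℝ) - 1 ≤ Real.exp (-(2 * t)) / 2 := by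
    refine ⟨-(n : ℝ), fun t ht => ?_⟩
    have := Real.add_one_le_exp (-(2 * t))
    linarith
  by_cases hA : ∃ s₁, ∀ s ≤ s₁, κ ≤ w (Real.exp (-s))
  · obtain ⟨s₁, hs₁⟩ := hA
    have hw := isWeightPair_reverse (d := (n : ℝ) - 2) (s₀ := min s₀ s₁) (by linarith)
      fun t ht => by linarith [hs₀ t (ht.trans (min_le_left _ _))]
    exact ⟨κ, min s₀ s₁, fun t ht =>
      (ho.eq_of_ge hp hκ hw (fun s hs => hs₁ s (hs.trans (min_le_right _ _))) t ht).le⟩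
  by_cases hB : ∃ s₁, ∀ s ≤ s₁, w (Real.exp (-s)) ≤ κ
  · obtain ⟨s₁, hs₁⟩ := hB
    exact ⟨κ, s₁, hs₁⟩
  push Not at hA hB
  have ha' : ∀ t, HasDerivAt (fun t => Real.exp (-(2 * t))) (-(2 * Real.exp (-(2 * t)))) t :=
    fun t => ((((hasDerivAt_id t).const_mul 2).neg).exp).congr_deriv (by
      simp only [id, Pi.neg_apply]; ring)
  obtain ⟨M, hM⟩ := ho.bounded_of_oscillating hp hκ (fun _ => Real.exp_pos _) hA hB (s₀ := s₀)
    (antitoneOn_of_hasDerivAt_nonpos (convex_Iic _)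
      (ho.hasDerivAt_energy hp (fun _ => Real.exp_pos _) ha') fun t ht => by
        have h0 := Real.exp_pos (-(2 * t))
        have h1 : -(2 * Real.exp (-(2 * t))) / (2 * Real.exp (-(2 * t))) = -1 := by
          field_simp
        have h2 := hs₀ t ht
        simp only [h1]
        exact neg_nonpos.2 (mul_nonneg (div_nonneg (by linarith) h0.le) (sq_nonneg _)))
  exact ⟨M, s₀, hM⟩

/-- A self-similar solution which is bounded at infinity and unbounded is singular. -/
theorem eq_singularSolution (h : IsSelfSimilarSolution σ n p w) (hσ : |σ| ≤ 1) (hn : 2 < n)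
    (hp : sobolevExponent n ≤ p) (htop : ∃ M s₁, ∀ s ≥ s₁, w (Real.exp s) ≤ M)
    (hunb : ¬ Bornology.IsBounded (w '' Ioi (0 : ℝ)))
    (hsign : p = sobolevExponent n →
      signChangeNumber (fun r => w r - singularSolution n p r) (Ioi (0 : ℝ)) < ⊤) :
    ∀ r : ℝ, 0 < r → w r = singularSolution n p r := by
  have hp1 := one_lt_of_sobolevExponent_le hn hp
  have hβ := damping_nonneg hn hp
  have ho := h.isPosOrbit_emdenFowler hn hp
  have hL := singularConstant_pos hn hp
  have hLp := singularConstant_rpow hn hp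
  have hm : 2 / (p - 1) * (p - 1) = 2 := div_mul_cancel₀ _ (by linarith)
  have hβpos : sobolevExponent n < p → 0 < (n : ℝ) - 2 - 2 * (2 / (p - 1)) := damping_pos hn
  have hsing := singularSolution_exp n p
  generalize (n : ℝ) - 2 - 2 * (2 / (p - 1)) = β at *
  generalize singularConstant n p = ℓ at *
  generalize 2 / (p - 1) = m at *
  have hfact : ∀ s, w (Real.exp s) - singularSolution n p (Real.exp s)
      = Real.exp (-(m * s)) * (Real.exp (m * s) * w (Real.exp s) - ℓ) := fun s => by
    have : Real.exp (-(m * s)) * Real.exp (m * s) = 1 := by rw [← Real.exp_add]; simp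
    rw [hsing]
    linear_combination -w (Real.exp s) * this
  have hb : ∀ s ≤ (0 : ℝ), |β + σ / 2 * Real.exp (2 * s) - β| ≤ Real.exp s := by
    intro s hs
    have h1 : Real.exp (2 * s) ≤ Real.exp s := Real.exp_le_exp.2 (by linarith)
    have h2 := Real.exp_pos (2 * s)
    rw [add_sub_cancel_left, abs_mul, abs_of_pos h2, abs_div, abs_two]
    nlinarith [abs_nonneg σ]
  have hfinish : ∀ s₀, (∀ s ≤ s₀, Real.exp (m * s) * w (Real.exp s) = ℓ) →
      ∀ r : ℝ, 0 < r → w r = singularSolution n p r := by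
    intro s₀ hs₀ r hr
    have h1 := ho.eq_of_eq_near_bot hp1 hL (by fun_prop) hs₀ (Real.log r)
    have h2 := hfact (Real.log r)
    rw [h1, sub_self, mul_zero, Real.exp_log hr] at h2
    exact sub_eq_zero.1 h2
  by_cases hA : ∃ s₁, ∀ s ≤ s₁, ℓ ≤ Real.exp (m * s) * w (Real.exp s)
  · obtain ⟨s₁, hs₁⟩ := hA
    exact hfinish (min 0 s₁) (ho.eq_of_ge hp1 hL
      (isWeightPair_emdenFowler hσ hβ (min_le_left _ _))
      fun s hs => hs₁ s (hs.trans (min_le_right _ _)))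
  by_cases hB : ∃ s₁, ∀ s ≤ s₁, Real.exp (m * s) * w (Real.exp s) ≤ ℓ
  · obtain ⟨s₁, hs₁⟩ := hB
    rcases ho.eq_or_tendsto_zero_of_le hp1
      (isWeightPair_emdenFowler hσ hβ (min_le_left 0 s₁))
      (fun s hs => hs₁ s (hs.trans (min_le_right _ _))) with hv | hv
    · exact hfinish _ hv
    · obtain ⟨D, s₂, hD, hs₂⟩ := ho.exists_le_exp_of_tendsto_zero hp1 hm hβ hLp hb hv
      refine absurd (isBounded_of_bounded_near_ends
        (fun r hr => (h.diff.1 r hr).continuousAt.continuousWithinAt) h.pos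
        ⟨D, s₂, fun s hs => ?_⟩ htop) hunb
      have h1 := hs₂ s hs
      rw [mul_comm] at h1
      exact le_of_mul_le_mul_right h1 (Real.exp_pos _)
  push Not at hA hB
  exfalso
  rcases hp.eq_or_lt with heq | hlt
  · refine (hsign heq.symm).ne (signChangeNumber_eq_top (fun t => ?_) fun t => ?_)
    · obtain ⟨s, hs, hsl⟩ := hA t
      exact ⟨s, hs, by
        rw [hfact]; exact mul_neg_of_pos_of_neg (Real.exp_pos _) (by linarith)⟩
    · obtain ⟨s, hs, hsl⟩ := hB t
      exact ⟨s, hs, by rw [hfact]; exact mul_pos (Real.exp_pos _) (by linarith)⟩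
  -- Above `p_S` the limiting damping `β` is positive, so `b` lies between `β/2` and `3β/2` near
  -- `-∞`.
  · have hβ0 := hβpos hlt
    obtain ⟨s₀, hs₀⟩ := eventually_atBot.1 ((eventually_le_atBot (0 : ℝ)).and
      ((tendsto_order.1 Real.tendsto_exp_atBot).2 _ (half_pos hβ0)))
    refine ho.not_oscillating hp1 hL (s₀ := s₀) (c := β / 2) (B := β + β / 2) (half_pos hβ0)
      (fun s hs => ?_) (fun s hs => ?_) hA hB
    · linarith [(abs_le.1 (hb s (hs₀ s hs).1)).1, (hs₀ s hs).2]
    · linarith [(abs_le.1 (hb s (hs₀ s hs).1)).2, (hs₀ s hs).2]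

end IsSelfSimilarSolution

theorem theorem1p1 (n : ℕ) (hn : 2 < n) (p : ℝ) (hp : sobolevExponent n ≤ p)
    (w : ℝ → ℝ) (hsol : IsForwardSolution n p w ∨ IsBackwardSolution n p w)
    (hpos : ∀ r : ℝ, 0 < r → 0 < w r)
    (hunb : ¬ Bornology.IsBounded (w '' Ioi (0 : ℝ)))
    (hsign : p = sobolevExponent n →
      signChangeNumber (fun r => w r - singularSolution n p r) (Ioi (0 : ℝ)) < ⊤) :
    ∀ r : ℝ, 0 < r → w r = singularSolution n p r := by
  have hp1 := one_lt_of_sobolevExponent_le hn hp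
  rcases hsol with ⟨hd, heq⟩ | ⟨hd, heq⟩
  · have h : IsSelfSimilarSolution 1 n p w :=
      ⟨hd, hpos, fun r hr => by linear_combination heq r hr⟩
    exact h.eq_singularSolution (by simp) hn hp (h.bounded_at_top_forward hn hp) hunb hsign
  · have h : IsSelfSimilarSolution (-1) n p w :=
      ⟨hd, hpos, fun r hr => by linear_combination heq r hr⟩
    exact h.eq_singularSolution (by simp) hn hp (h.bounded_at_top_backward hn hp1) hunb hsign
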